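/- Theorem. Let $\Box$ be the full subcategory of topological spaces on the cubes $I^n=[0,1]^n$ and their boundaries $\partial I^n$, $n\ge 0$ (so $\partial I^0=\emptyset$, $I^0=*$), with the boundary inclusions $i_n\colon\partial I^n\to I^n$, the inclusions $j_n\colon I^n\cong I^n\times\{0\}\to I^n\times I=I^{n+1}$ and the endpoint inclusions $e_0,e_1$ of $*$ into $I=I^1$ (and into $\partial I=\{0,1\}$). Let $C$ be a category with all small limits and colimits and let $\iota\colon\Box\to C$ be an embedding (a faithful functor); we write $\emptyset,*,I^n,\partial I^n,i_n,j_n,e_k$ also for the images under $\iota$. For a class $K$ of maps of $C$ let $\mathrm{cell}(K)$ be the class of transfinite compositions of pushouts of coproducts of maps in $K$, $\mathrm{cof}(K)$ its closure under retracts, and $\mathrm{rlp}(K)$ the class of maps with the right lifting property against $K$. Put $\mathcal I=\{i_n\}_{n\ge0}$, $\mathcal J=\{j_n\}_{n\ge0}$ (in $C$); $f\mathbin{\hat\times}g$ denotes the pushout product with respect to the product of $C$. Assume that $(C,\iota)$ is a Q-structure: (S1) $\emptyset$ is initial and $*$ is terminal in $C$; (S2) $\iota$ preserves the product $I^2=I\times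 I$; (S3) there are maps $a,b\colon I\to I$ in $\Box$ with $a(0)=0$, $b(1)=1$ such that the square with $a e_1=b e_0$ is a pushout in $\Box$, is preserved by $\iota$, and its image remains a pushout after applying $X\times -$ for every $X\in C$; (S4) $\emptyset\times X\cong\emptyset$ for all $X\in C$; (Q2) for all $X\in C$, $X\times\partial I$ is a coproduct $X\amalg X$ with inclusions $\mathrm{id}_X\times e_0$, $\mathrm{id}_X\times e_1$; (Q3) $\mathcal I\mathbin{\hat\times}\mathcal I\subseteq\mathrm{cof}(\mathcal I)$ and $\mathcal I\mathbin{\hat\times}\mathcal J\subseteq\mathrm{cof}(\mathcal J)$; (Q4) $\mathcal J\subseteq\mathrm{cof}(\mathcal I)$, and $\emptyset\to\partial I^n$ is in $\mathrm{cof}(\mathcal I)$ for all $n\ge0$; (Q5) $\partial I^n$ and $I^n$ are exponentiable in $C$ (that is, $-\times\partial I^n$ and $-\times I^n$ have right adjoints) for all $n\ge0$; (Q6) for all $n\ge0$, $\partial I^n$ is small relative to $\mathrm{cell}(\mathcal I)$ and $I^n$ is small relative to $\mathrm{cell}(\mathcal J)$. Here $A$ is small relative to a class $D$ if there is a cardinal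 $\kappa$ such that for every regular cardinal $\mu\ge\kappa$ the functor $C(A,-)$ preserves the colimit of every $\mu$-sequence (colimit-preserving functor on the ordinal $\mu$) whose successor maps lie in $D$. (Axiom (Q1) is the conjunction of (S1)-(S4).) Then there is a model structure on $C$ in which the cofibrations are the maps in $\mathrm{cof}(\mathcal I)$, the fibrations are the maps in $\mathrm{rlp}(\mathcal J)$, and the weak equivalences are the maps $f\colon X\to Y$ such that for every $n\ge0$ and all $u\colon\partial I^n\to X$, $v\colon I^n\to Y$ with $fu=vi_n$ there is $h\colon I^n\to X$ with $hi_n=u$ and a homotopy from $fh$ to $v$ relative to $\partial I^n$, i.e. a map $H\colon I^n\times I\to Y$ (product in $C$) with $H\circ(\mathrm{id}\times e_0)=fh$, $H\circ(\mathrm{id}\times e_1)=v$ (identifying $I^n\times *$ with $I^n$) and $H\circ(i_n\times\mathrm{id}_I)=v\,i_n\circ\mathrm{pr}_1$. -/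

import Mathlib

open CategoryTheory CategoryTheory.Limits

universe v u

namespace Serre

/-- Objects of the cube category: the cubes `Iⁿ` and their boundaries `∂Iⁿ`, for `n ≥ 0`.
In particular `boundary 0` is the empty space, `cube 0` is a point and `cube 1` is `I`. -/
inductive Box : Type
  | cube (n : ℕ) : Box
  | boundary (n : ℕ) : Box

namespace Box

/-- The topological space underlying an object of the cube category. -/
abbrev space : Box → TopCat.{0}
  | cube n => TopCat.of (Fin n → unitInterval)
  | boundary n => TopCat.of (Cube.boundary (Fin n))

/-- The cube category is a full subcategory of topological spaces: its morphisms are all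
continuous maps. -/
instance : Category.{0} Box where
  Hom X Y := C(X.space, Y.space)
  id X := ContinuousMap.id X.space
  comp f g := g.comp f

/-- The inclusion `iₙ : ∂Iⁿ ⟶ Iⁿ`. -/
def i (n : ℕ) : boundary n ⟶ cube n :=
  (⟨Subtype.val, continuous_subtype_val⟩ : C(Cube.boundary (Fin n), Fin n → unitInterval))

/-- The inclusion `jₙ : Iⁿ ≅ Iⁿ × {0} ⟶ Iⁿ × I = Iⁿ⁺¹`, `x ↦ (x, 0)`. -/
def j (n : ℕ) : cube n ⟶ cube (n + 1) :=
  (⟨fun x => Fin.snoc (α := fun _ => unitInterval) x 0, by fun_prop⟩ :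
    C(Fin n → unitInterval, Fin (n + 1) → unitInterval))

/-- The endpoint inclusion `e₀ : * ⟶ I`. -/
def e₀ : cube 0 ⟶ cube 1 :=
  (ContinuousMap.const _ (fun _ => 0) : C(Fin 0 → unitInterval, Fin 1 → unitInterval))

/-- The endpoint inclusion `e₁ : * ⟶ I`. -/
def e₁ : cube 0 ⟶ cube 1 :=
  (ContinuousMap.const _ (fun _ => 1) : C(Fin 0 → unitInterval, Fin 1 → unitInterval))

/-- The endpoint inclusion `e₀ : * ⟶ ∂I`. -/
def de₀ : cube 0 ⟶ boundary 1 :=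
  (ContinuousMap.const _ ⟨fun _ => 0, 0, Or.inl rfl⟩ :
    C(Fin 0 → unitInterval, Cube.boundary (Fin 1)))

/-- The endpoint inclusion `e₁ : * ⟶ ∂I`. -/
def de₁ : cube 0 ⟶ boundary 1 :=
  (ContinuousMap.const _ ⟨fun _ => 1, 0, Or.inr rfl⟩ :
    C(Fin 0 → unitInterval, Cube.boundary (Fin 1)))

/-- The coordinate projections `I² ⟶ I`. -/
def proj (k : Fin 2) : cube 2 ⟶ cube 1 :=
  (⟨fun x _ => x k, by fun_prop⟩ : C(Fin 2 → unitInterval, Fin 1 → unitInterval))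

/-- The value of a self-map of `I` in the cube category at a point of `I`. -/
def eval (a : cube 1 ⟶ cube 1) (t : unitInterval) : unitInterval :=
  (show C(Fin 1 → unitInterval, Fin 1 → unitInterval) from a) (fun _ => t) 0

end Box

variable {C : Type u} [Category.{v} C]

/-! ### Cell complexes and smallness -/

/-- Relative cell complexes: transfinite compositions of pushouts of (small) coproducts of
maps in `W`. -/
def cell (W : MorphismProperty C) : MorphismProperty C :=
  MorphismProperty.transfiniteCompositions.{v}
    (MorphismProperty.coproducts.{v} W).pushouts

/-- The closure of the relative cell complexes under retracts. -/
def cof (W : MorphismProperty C) : MorphismProperty C :=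
  (cell W).retracts

/-- `A` is small relative to `D`: there is a cardinal `κ` such that for each regular cardinal
`μ ≥ κ`, the functor `Hom(A, -)` preserves the colimit of each `μ`-sequence (a functor `F` on the
ordinal `μ`, continuous at limit ordinals) whose successor maps `F β ⟶ F (β + 1)` are in `D`. -/
def IsSmallRelativeTo (A : C) (D : MorphismProperty C) : Prop :=
  ∃ κ : Cardinal.{v}, ∀ (μ : Cardinal.{v}) [Fact μ.IsRegular] [OrderBot μ.ord.ToType],
    κ ≤ μ → ∀ {X Y : C} (f : X ⟶ Y) (h : D.TransfiniteCompositionOfShape μ.ord.ToType f),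
      PreservesColimit h.F (coyoneda.obj (Opposite.op A))

/-! ### Pushout products and exponentiable objects -/

/-- The pushout product `X × B ⨿_{X × A} Y × A ⟶ Y × B` of `f : X ⟶ Y` and `g : A ⟶ B`. -/
noncomputable def pushoutProduct [HasLimits C] [HasColimits C] {X Y A B : C}
    (f : X ⟶ Y) (g : A ⟶ B) :
    pushout (prod.map (𝟙 X) g) (prod.map f (𝟙 A)) ⟶ Y ⨯ B :=
  pushout.desc (prod.map f (𝟙 B)) (prod.map (𝟙 Y) g) (by simp)

/-- `A` is exponentiable: the functor `- × A` has a right adjoint. -/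
def IsExponentiable [HasLimits C] (A : C) : Prop :=
  ((prod.functor (C := C)).flip.obj A).IsLeftAdjoint

/-! ### The generating maps -/

section

variable (ι : Box ⥤ C)

/-- The generating cofibrations: the images in `C` of the inclusions `∂Iⁿ ⟶ Iⁿ`. -/
def genCof : MorphismProperty C :=
  MorphismProperty.ofHoms fun n : ℕ => ι.map (Box.i n)

/-- The generating trivial cofibrations: the images in `C` of the inclusions
`Iⁿ × {0} ⟶ Iⁿ × I`. -/
def genTrivCof : MorphismProperty C :=
  MorphismProperty.ofHoms fun n : ℕ => ι.map (Box.j n)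

end

/-! ### The axioms -/

/-- The axioms (S1)-(S4) of a category with intervals. They only involve the cubes and boundaries
of dimension at most two. -/
structure IsCategoryWithIntervals [HasLimits C] [HasColimits C] (ι : Box ⥤ C) : Prop where
  /-- (S1) `ι ∅` is initial. -/
  isInitial : Nonempty (IsInitial (ι.obj (.boundary 0)))
  /-- (S1) `ι *` is terminal. -/
  isTerminal : Nonempty (IsTerminal (ι.obj (.cube 0)))
  /-- (S2) `ι I²` is the product of `ι I` with itself, by the coordinate projections. -/
  isProduct : Nonempty (IsLimit (BinaryFan.mk (ι.map (Box.proj 0)) (ι.map (Box.proj 1))))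
  /-- (S3) `ι` preserves some pushout exhibiting `I` as two copies of `I` glued end to end, and so
  does `X × ι -` for each `X`. -/
  isPushout : ∃ a b : Box.cube 1 ⟶ Box.cube 1, Box.eval a 0 = 0 ∧ Box.eval b 1 = 1 ∧
    IsPushout Box.e₁ Box.e₀ a b ∧
    IsPushout (ι.map Box.e₁) (ι.map Box.e₀) (ι.map a) (ι.map b) ∧
    ∀ X : C, IsPushout (prod.map (𝟙 X) (ι.map Box.e₁)) (prod.map (𝟙 X) (ι.map Box.e₀))
      (prod.map (𝟙 X) (ι.map a)) (prod.map (𝟙 X) (ι.map b))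
  /-- (S4) `∅ × X ≅ ∅`. -/
  empty_prod (X : C) : Nonempty ((⊥_ C) ⨯ X ≅ ⊥_ C)

/-- A Q-structure on a bicomplete category `C`: an embedding `ι` of the cube category in `C`
satisfying the axioms (Q1)-(Q6). -/
structure IsQStructure [HasLimits C] [HasColimits C] (ι : Box ⥤ C) : Prop
    extends IsCategoryWithIntervals ι where
  /-- `ι` is an embedding. -/
  faithful : ι.Faithful
  /-- (Q2) `X × ∂I` is the coproduct of two copies of `X` (here `X × *`), with coproduct inclusions
  `id × e₀` and `id × e₁`. -/
  prod_boundary (X : C) : Nonempty (IsColimit (BinaryCofan.mk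
    (prod.map (𝟙 X) (ι.map Box.de₀)) (prod.map (𝟙 X) (ι.map Box.de₁))))
  /-- (Q3), first part. -/
  pushoutProduct_i_i (m n : ℕ) :
    cof (genCof ι) (pushoutProduct (ι.map (Box.i m)) (ι.map (Box.i n)))
  /-- (Q3), second part. -/
  pushoutProduct_i_j (m n : ℕ) :
    cof (genTrivCof ι) (pushoutProduct (ι.map (Box.i m)) (ι.map (Box.j n)))
  /-- (Q4), first part. -/
  cof_j (n : ℕ) : cof (genCof ι) (ι.map (Box.j n))
  /-- (Q4), second part: the boundaries of cubes are cofibrant. -/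
  cof_boundary (n : ℕ) : cof (genCof ι) (initial.to (ι.obj (.boundary n)))
  /-- (Q5) -/
  exponentiable_boundary (n : ℕ) : IsExponentiable (ι.obj (.boundary n))
  /-- (Q5) -/
  exponentiable_cube (n : ℕ) : IsExponentiable (ι.obj (.cube n))
  /-- (Q6) -/
  small_boundary (n : ℕ) : IsSmallRelativeTo (ι.obj (.boundary n)) (cell (genCof ι))
  /-- (Q6) -/
  small_cube (n : ℕ) : IsSmallRelativeTo (ι.obj (.cube n)) (cell (genTrivCof ι))

/-! ### Homotopies and weak equivalences -/

/-- `H : X × I ⟶ Y` is a homotopy from `f` to `g`. The endpoint inclusions of the cylinder are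
written as maps `id × eₖ : X × * ⟶ X × I`, where `prod.fst : X × * ⟶ X` is an isomorphism as soon as
`ι *` is terminal. -/
structure IsHomotopy [HasLimits C] (ι : Box ⥤ C) {X Y : C} (f g : X ⟶ Y)
    (H : X ⨯ ι.obj (.cube 1) ⟶ Y) : Prop where
  at_zero : prod.map (𝟙 X) (ι.map Box.e₀) ≫ H = prod.fst ≫ f
  at_one : prod.map (𝟙 X) (ι.map Box.e₁) ≫ H = prod.fst ≫ g

/-- `f` and `g` agree on `A` (along `i : A ⟶ X`) and are homotopic relative to `A`. -/
def HomotopicRel [HasLimits C] (ι : Box ⥤ C) {A X Y : C} (i : A ⟶ X) (f g : X ⟶ Y) : Prop :=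
  i ≫ f = i ≫ g ∧ ∃ H : X ⨯ ι.obj (.cube 1) ⟶ Y, IsHomotopy ι f g H ∧
    prod.map i (𝟙 (ι.obj (.cube 1))) ≫ H = prod.fst ≫ i ≫ f

/-- `f` is `n`-compressible: each square from `∂Iⁿ ⟶ Iⁿ` to `f` has a diagonal filler whose upper
triangle commutes strictly and whose lower triangle commutes up to homotopy relative to `∂Iⁿ`. -/
def IsCompressible [HasLimits C] (ι : Box ⥤ C) (n : ℕ) {X Y : C} (f : X ⟶ Y) : Prop :=
  ∀ (u : ι.obj (.boundary n) ⟶ X) (v : ι.obj (.cube n) ⟶ Y), u ≫ f = ι.map (Box.i n) ≫ v →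
    ∃ h : ι.obj (.cube n) ⟶ X, ι.map (Box.i n) ≫ h = u ∧
      HomotopicRel ι (ι.map (Box.i n)) (h ≫ f) v

/-- `f` is `n`-connected: it is `k`-compressible for all `k ≤ n`. -/
def IsNConnected [HasLimits C] (ι : Box ⥤ C) (n : ℕ) {X Y : C} (f : X ⟶ Y) : Prop :=
  ∀ k ≤ n, IsCompressible ι k f

/-- The weak equivalences: the maps which are `n`-connected for all `n`. -/
def weakEq [HasLimits C] (ι : Box ⥤ C) : MorphismProperty C :=
  fun _ _ f => ∀ n : ℕ, IsNConnected ι n f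

end Serre

namespace Serre

open HomotopicalAlgebra

/-! ### The small object argument -/

section SmallObject

variable {C : Type u} [Category.{v} C]

lemma pushouts_coproducts_le_cell (W : MorphismProperty C) :
    (MorphismProperty.coproducts.{v} W).pushouts ≤ cell W := by
  unfold cell
  exact MorphismProperty.le_transfiniteCompositions _

lemma hasSmallObjectArgument_ofHoms [HasColimits C] {A B : ℕ → C} (k : ∀ n, A n ⟶ B n)
    (h : ∀ n, IsSmallRelativeTo (A n) (cell (MorphismProperty.ofHoms k))) :
    MorphismProperty.HasSmallObjectArgument.{v} (MorphismProperty.ofHoms k) := by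
  choose κ hκ using h
  let μ : Cardinal.{v} := Order.succ (max Cardinal.aleph0 (⨆ n, κ n))
  have hμ : μ.IsRegular := Cardinal.isRegular_succ (le_max_left _ _)
  have hle (n : ℕ) : κ n ≤ μ :=
    (le_ciSup Cardinal.bddAbove_of_small n).trans
      ((le_max_right _ _).trans (Order.le_succ _))
  have : Fact μ.IsRegular := ⟨hμ⟩
  have : Nonempty μ.ord.ToType := by
    rw [Ordinal.nonempty_toType_iff]
    intro h0
    exact hμ.ne_zero (by simpa using h0)
  let : OrderBot μ.ord.ToType := WellFoundedLT.toOrderBot _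
  refine ⟨μ, inferInstance, inferInstance, ?_⟩
  exact
    { isSmall := MorphismProperty.isSmall_ofHoms.{v} k
      preservesColimit := by
        rintro _ _ X Y _ ⟨n⟩ f hf
        let t := (hf.transfiniteCompositionOfShape).ofLE (W' := cell (.ofHoms k))
          (by
            rw [MorphismProperty.ofHoms_homFamily]
            exact pushouts_coproducts_le_cell _)
        exact hκ n μ (hle n) f t }

lemma cof_eq_llp (W : MorphismProperty C) [MorphismProperty.HasSmallObjectArgument.{v} W] :
    cof W = W.rlp.llp :=
  (MorphismProperty.llp_rlp_of_hasSmallObjectArgument.{v} W).symm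

end SmallObject

/-! ### Lifting against pushout products -/

section PushoutProduct

variable {C : Type u} [Category.{v} C] [HasLimits C] [HasColimits C]

lemma inl_pushoutProduct {X Y A B : C} (f : X ⟶ Y) (g : A ⟶ B) :
    pushout.inl _ _ ≫ pushoutProduct f g = prod.map f (𝟙 B) :=
  pushout.inl_desc _ _ _

lemma inr_pushoutProduct {X Y A B : C} (f : X ⟶ Y) (g : A ⟶ B) :
    pushout.inr _ _ ≫ pushoutProduct f g = prod.map (𝟙 Y) g :=
  pushout.inr_desc _ _ _

lemma inl_pushoutProduct_assoc {X Y A B Z : C} (f : X ⟶ Y) (g : A ⟶ B) (h : Y ⨯ B ⟶ Z) :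
    pushout.inl _ _ ≫ pushoutProduct f g ≫ h = prod.map f (𝟙 B) ≫ h := by
  rw [← Category.assoc, inl_pushoutProduct]

lemma inr_pushoutProduct_assoc {X Y A B Z : C} (f : X ⟶ Y) (g : A ⟶ B) (h : Y ⨯ B ⟶ Z) :
    pushout.inr _ _ ≫ pushoutProduct f g ≫ h = prod.map (𝟙 Y) g ≫ h := by
  rw [← Category.assoc, inr_pushoutProduct]

lemma exists_lift_of_pushoutProduct {X Y A B E F : C} {f : X ⟶ Y} {g : A ⟶ B} {p : E ⟶ F}
    (h : HasLiftingProperty (pushoutProduct f g) p) (a : X ⨯ B ⟶ E) (b : Y ⨯ A ⟶ E)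
    (c : Y ⨯ B ⟶ F) (hab : prod.map (𝟙 X) g ≫ a = prod.map f (𝟙 A) ≫ b)
    (hac : prod.map f (𝟙 B) ≫ c = a ≫ p) (hbc : prod.map (𝟙 Y) g ≫ c = b ≫ p) :
    ∃ K : Y ⨯ B ⟶ E, prod.map f (𝟙 B) ≫ K = a ∧ prod.map (𝟙 Y) g ≫ K = b ∧ K ≫ p = c := by
  have sq : CommSq (pushout.desc a b hab) (pushoutProduct f g) p c := ⟨by
    ext
    · rw [pushout.inl_desc_assoc, inl_pushoutProduct_assoc, hac]
    · rw [pushout.inr_desc_assoc, inr_pushoutProduct_assoc, hbc]⟩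
  refine ⟨sq.lift, ?_, ?_, sq.fac_right⟩
  · rw [← inl_pushoutProduct_assoc, sq.fac_left, pushout.inl_desc]
  · rw [← inr_pushoutProduct_assoc, sq.fac_left, pushout.inr_desc]

lemma hasLiftingProperty_pushoutProduct_symm {X Y A B E F : C} {f : X ⟶ Y} {g : A ⟶ B}
    {p : E ⟶ F} (h : HasLiftingProperty (pushoutProduct f g) p) :
    HasLiftingProperty (pushoutProduct g f) p := by
  refine ⟨fun {s c} sq => ?_⟩
  obtain ⟨K, h₁, h₂, h₃⟩ := exists_lift_of_pushoutProduct h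
    ((prod.braiding _ _).hom ≫ pushout.inr _ _ ≫ s)
    ((prod.braiding _ _).hom ≫ pushout.inl _ _ ≫ s) ((prod.braiding _ _).hom ≫ c)
    (by rw [braid_natural_assoc, braid_natural_assoc, pushout.condition_assoc])
    (by rw [Category.assoc, Category.assoc, sq.w, inr_pushoutProduct_assoc, braid_natural_assoc])
    (by rw [Category.assoc, Category.assoc, sq.w, inl_pushoutProduct_assoc, braid_natural_assoc])
  refine ⟨⟨⟨(prod.braiding _ _).hom ≫ K, ?_, ?_⟩⟩⟩
  · ext
    · rw [inl_pushoutProduct_assoc, braid_natural_assoc, h₂,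
        ← Category.assoc (prod.braiding _ _).hom, prod.symmetry,
        Category.id_comp]
    · rw [inr_pushoutProduct_assoc, braid_natural_assoc, h₁,
        ← Category.assoc (prod.braiding _ _).hom, prod.symmetry,
        Category.id_comp]
  · rw [Category.assoc, h₃, ← Category.assoc (prod.braiding _ _).hom, prod.symmetry,
      Category.id_comp]

end PushoutProduct

/-! ### Maps of the cube category -/

namespace Box

/-- The endpoint inclusions of `I`, indexed by booleans. -/
def endpoint : Bool → (cube 0 ⟶ cube 1)
  | false => e₀
  | true => e₁

/-- The endpoint inclusions of `∂I`, indexed by booleans. -/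
def boundaryEndpoint : Bool → (cube 0 ⟶ boundary 1)
  | false => de₀
  | true => de₁

lemma boundaryEndpoint_i (k : Bool) : boundaryEndpoint k ≫ i 1 = endpoint k := by
  cases k <;> rfl

/-- The reversal of `I`. -/
def reversal : cube 1 ⟶ cube 1 :=
  (⟨fun x k => unitInterval.symm (x k), by fun_prop⟩ :
    C(Fin 1 → unitInterval, Fin 1 → unitInterval))

lemma reversal_reversal : reversal ≫ reversal = 𝟙 _ :=
  ContinuousMap.ext fun _ => funext fun _ => unitInterval.symm_symm _

lemma endpoint_reversal (k : Bool) : endpoint k ≫ reversal = endpoint (!k) := by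
  cases k
  · exact ContinuousMap.ext fun _ => funext fun _ => unitInterval.symm_zero
  · exact ContinuousMap.ext fun _ => funext fun _ => unitInterval.symm_one

/-- The projection `I ⟶ *`. -/
def collapse : cube 1 ⟶ cube 0 :=
  (ContinuousMap.const _ Fin.elim0 : C(Fin 1 → unitInterval, Fin 0 → unitInterval))

/-- The connections `I² ⟶ I`: the endpoint `k` is absorbing and the opposite endpoint is
neutral. -/
def connection : Bool → (cube 2 ⟶ cube 1)
  | false => (⟨fun x _ => x 0 ⊓ x 1, by fun_prop⟩ :
      C(Fin 2 → unitInterval, Fin 1 → unitInterval))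
  | true => (⟨fun x _ => x 0 ⊔ x 1, by fun_prop⟩ :
      C(Fin 2 → unitInterval, Fin 1 → unitInterval))

/-- The map `I ⟶ I²` with given coordinates. -/
def pair (a b : cube 1 ⟶ cube 1) : cube 1 ⟶ cube 2 :=
  (⟨fun x => ![(show C(Fin 1 → unitInterval, Fin 1 → unitInterval) from a) x 0,
      (show C(Fin 1 → unitInterval, Fin 1 → unitInterval) from b) x 0], by
    have h (c : C(Fin 1 → unitInterval, Fin 1 → unitInterval)) : Continuous fun x => c x 0 := by
      fun_prop
    refine continuous_pi fun k => ?_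
    fin_cases k
    · exact h a
    · exact h b⟩ :
    C(Fin 1 → unitInterval, Fin 2 → unitInterval))

lemma pair_proj_zero (a b : cube 1 ⟶ cube 1) : pair a b ≫ proj 0 = a := by
  refine ContinuousMap.ext fun x => funext fun k => ?_
  rw [Subsingleton.elim k 0]
  rfl

lemma pair_proj_one (a b : cube 1 ⟶ cube 1) : pair a b ≫ proj 1 = b := by
  refine ContinuousMap.ext fun x => funext fun k => ?_
  rw [Subsingleton.elim k 0]
  rfl

lemma pair_endpoint_id_connection (k : Bool) :
    pair (collapse ≫ endpoint k) (𝟙 _) ≫ connection k = collapse ≫ endpoint k := by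
  refine ContinuousMap.ext fun x => funext fun l => ?_
  cases k
  · exact inf_eq_left.2 unitInterval.nonneg'
  · exact sup_eq_left.2 unitInterval.le_one'

lemma pair_id_endpoint_connection (k : Bool) :
    pair (𝟙 _) (collapse ≫ endpoint k) ≫ connection k = collapse ≫ endpoint k := by
  refine ContinuousMap.ext fun x => funext fun l => ?_
  cases k
  · exact inf_eq_right.2 unitInterval.nonneg'
  · exact sup_eq_right.2 unitInterval.le_one'

lemma pair_endpoint_not_id_connection (k : Bool) :
    pair (collapse ≫ endpoint (!k)) (𝟙 _) ≫ connection k = 𝟙 _ := by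
  refine ContinuousMap.ext fun x => funext fun l => ?_
  rw [Subsingleton.elim l 0]
  cases k
  · exact inf_eq_right.2 unitInterval.le_one'
  · exact sup_eq_right.2 unitInterval.nonneg'

lemma pair_id_endpoint_not_connection (k : Bool) :
    pair (𝟙 _) (collapse ≫ endpoint (!k)) ≫ connection k = 𝟙 _ := by
  refine ContinuousMap.ext fun x => funext fun l => ?_
  rw [Subsingleton.elim l 0]
  cases k
  · exact inf_eq_left.2 unitInterval.le_one'
  · exact sup_eq_left.2 unitInterval.nonneg'

/-- The projection `Iⁿ⁺¹ ⟶ Iⁿ` which forgets the last coordinate. -/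
def init (n : ℕ) : cube (n + 1) ⟶ cube n :=
  (⟨fun x => Fin.init x, by unfold Fin.init; fun_prop⟩ :
    C(Fin (n + 1) → unitInterval, Fin n → unitInterval))

lemma j_init (n : ℕ) : j n ≫ init n = 𝟙 _ :=
  ContinuousMap.ext fun x => Fin.init_snoc (α := fun _ => unitInterval) 0 x

lemma j_zero : j 0 = e₀ :=
  ContinuousMap.ext fun x => funext fun k => by
    obtain rfl : k = Fin.last 0 := Subsingleton.elim (α := Fin 1) _ _
    exact Fin.snoc_last (α := fun _ => unitInterval) 0 x

end Box

/-! ### Cylinders and path objects -/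

section Path

variable {C : Type u} [Category.{v} C] [HasLimits C] [HasColimits C] {ι : Box ⥤ C}
  (hι : IsQStructure ι)

/-- The map to `*`. -/
noncomputable def toPt (X : C) : X ⟶ ι.obj (.cube 0) := hι.isTerminal.some.from X

include hι in
lemma toPt_ext {X : C} (f g : X ⟶ ι.obj (.cube 0)) : f = g := hι.isTerminal.some.hom_ext f g

/-- The constant map to `I` at an endpoint. -/
noncomputable def endAt (k : Bool) (X : C) : X ⟶ ι.obj (.cube 1) :=
  toPt hι X ≫ ι.map (Box.endpoint k)

@[simp]
lemma comp_endAt (k : Bool) {X Y : C} (f : X ⟶ Y) : f ≫ endAt hι k Y = endAt hι k X := by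
  rw [endAt, ← Category.assoc, toPt_ext hι (f ≫ toPt hι Y) (toPt hι X), endAt]

/-- The inclusion of an end of the cylinder. -/
noncomputable def cylEnd (k : Bool) (X : C) : X ⟶ X ⨯ ι.obj (.cube 1) :=
  prod.lift (𝟙 X) (endAt hι k X)

@[simp]
lemma cylEnd_fst (k : Bool) (X : C) : cylEnd hι k X ≫ prod.fst = 𝟙 X := by
  rw [cylEnd, prod.lift_fst]

@[simp]
lemma cylEnd_fst_assoc (k : Bool) {X Y : C} (f : X ⟶ Y) :
    cylEnd hι k X ≫ prod.fst ≫ f = f := by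
  rw [← Category.assoc, cylEnd_fst, Category.id_comp]

lemma cylEnd_map (k : Bool) {X Y : C} (f : X ⟶ Y) :
    cylEnd hι k X ≫ prod.map f (𝟙 _) = f ≫ cylEnd hι k Y := by
  simp [cylEnd, prod.comp_lift]

lemma cylEnd_map_assoc (k : Bool) {X Y Z : C} (f : X ⟶ Y) (g : Y ⨯ ι.obj (.cube 1) ⟶ Z) :
    cylEnd hι k X ≫ prod.map f (𝟙 _) ≫ g = f ≫ cylEnd hι k Y ≫ g := by
  rw [← Category.assoc, cylEnd_map, Category.assoc]

lemma map_endpoint (k : Bool) (X : C) :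
    prod.map (𝟙 X) (ι.map (Box.endpoint k)) = prod.fst ≫ cylEnd hι k X := by
  ext
  · simp
  · rw [Category.assoc, cylEnd, prod.lift_snd, comp_endAt, prod.map_snd, endAt,
      toPt_ext hι prod.snd (toPt hι _)]

lemma map_endpoint_comp_iff (k : Bool) {X Y : C} (H : X ⨯ ι.obj (.cube 1) ⟶ Y) (f : X ⟶ Y) :
    prod.map (𝟙 X) (ι.map (Box.endpoint k)) ≫ H = prod.fst ≫ f ↔ cylEnd hι k X ≫ H = f := by
  rw [map_endpoint hι, Category.assoc]
  refine ⟨fun h => ?_, fun h => by rw [h]⟩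
  simpa [prod.lift_fst_assoc] using prod.lift (𝟙 X) (toPt hι X) ≫= h

/-- The path object functor, right adjoint to the cylinder functor. -/
noncomputable def path : C ⥤ C :=
  haveI : ((prod.functor (C := C)).flip.obj (ι.obj (.cube 1))).IsLeftAdjoint :=
    hι.exponentiable_cube 1
  ((prod.functor (C := C)).flip.obj (ι.obj (.cube 1))).rightAdjoint

/-- Homotopies as maps to the path object. -/
noncomputable def curry {A Y : C} : (A ⨯ ι.obj (.cube 1) ⟶ Y) ≃ (A ⟶ (path hι).obj Y) :=
  haveI : ((prod.functor (C := C)).flip.obj (ι.obj (.cube 1))).IsLeftAdjoint :=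
    hι.exponentiable_cube 1
  (Adjunction.ofIsLeftAdjoint
    ((prod.functor (C := C)).flip.obj (ι.obj (.cube 1)))).homEquiv A Y

lemma comp_curry {A B Y : C} (f : A ⟶ B) (H : B ⨯ ι.obj (.cube 1) ⟶ Y) :
    f ≫ curry hι H = curry hι (prod.map f (𝟙 _) ≫ H) :=
  have : ((prod.functor (C := C)).flip.obj (ι.obj (.cube 1))).IsLeftAdjoint :=
    hι.exponentiable_cube 1
  ((Adjunction.ofIsLeftAdjoint
    ((prod.functor (C := C)).flip.obj (ι.obj (.cube 1)))).homEquiv_naturality_left f H).symm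

lemma curry_map {A Y Z : C} (H : A ⨯ ι.obj (.cube 1) ⟶ Y) (g : Y ⟶ Z) :
    curry hι H ≫ (path hι).map g = curry hι (H ≫ g) :=
  have : ((prod.functor (C := C)).flip.obj (ι.obj (.cube 1))).IsLeftAdjoint :=
    hι.exponentiable_cube 1
  ((Adjunction.ofIsLeftAdjoint
    ((prod.functor (C := C)).flip.obj (ι.obj (.cube 1)))).homEquiv_naturality_right H g).symm

lemma map_curry_symm {A B Y : C} (f : A ⟶ B) (H : B ⟶ (path hι).obj Y) :
    prod.map f (𝟙 _) ≫ (curry hι).symm H = (curry hι).symm (f ≫ H) := by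
  rw [Equiv.eq_symm_apply, ← comp_curry, Equiv.apply_symm_apply]

/-- Evaluation of paths at an endpoint. -/
noncomputable def ev (k : Bool) (Y : C) : (path hι).obj Y ⟶ Y :=
  cylEnd hι k _ ≫ (curry hι).symm (𝟙 _)

lemma comp_ev (k : Bool) {A Y : C} (H : A ⟶ (path hι).obj Y) :
    H ≫ ev hι k Y = cylEnd hι k A ≫ (curry hι).symm H := by
  rw [ev, ← cylEnd_map_assoc, map_curry_symm, Category.comp_id]

@[simp]
lemma curry_ev (k : Bool) {A Y : C} (H : A ⨯ ι.obj (.cube 1) ⟶ Y) :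
    curry hι H ≫ ev hι k Y = cylEnd hι k A ≫ H := by
  rw [comp_ev, Equiv.symm_apply_apply]

@[simp]
lemma path_map_ev (k : Bool) {Y Z : C} (g : Y ⟶ Z) :
    (path hι).map g ≫ ev hι k Z = ev hι k Y ≫ g := by
  obtain ⟨H, hH⟩ := (curry hι).surjective (𝟙 ((path hι).obj Y))
  rw [← Category.id_comp ((path hι).map g), ← Category.id_comp (ev hι k Y), ← hH, curry_map,
    curry_ev, curry_ev, Category.assoc]

/-- Constant paths. -/
noncomputable def constPath (Y : C) : Y ⟶ (path hι).obj Y := curry hι prod.fst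

@[simp]
lemma constPath_ev (k : Bool) (Y : C) : constPath hι Y ≫ ev hι k Y = 𝟙 Y := by
  simp [constPath]

@[simp]
lemma constPath_ev_assoc (k : Bool) {X Y : C} (h : Y ⟶ X) :
    constPath hι Y ≫ ev hι k Y ≫ h = h := by
  rw [← Category.assoc, constPath_ev, Category.id_comp]

lemma comp_constPath {Y Z : C} (g : Y ⟶ Z) :
    g ≫ constPath hι Z = curry hι (prod.fst ≫ g) := by
  rw [constPath, comp_curry, prod.map_fst]

@[simp]
lemma constPath_map {Y Z : C} (g : Y ⟶ Z) :
    constPath hι Y ≫ (path hι).map g = g ≫ constPath hι Z := by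
  rw [comp_constPath, constPath, curry_map]

/-- Reversal of paths. -/
noncomputable def revPath (Y : C) : (path hι).obj Y ⟶ (path hι).obj Y :=
  curry hι (prod.map (𝟙 _) (ι.map Box.reversal) ≫ (curry hι).symm (𝟙 _))

lemma comp_revPath {A Y : C} (H : A ⟶ (path hι).obj Y) :
    H ≫ revPath hι Y =
      curry hι (prod.map (𝟙 _) (ι.map Box.reversal) ≫ (curry hι).symm H) := by
  rw [revPath, comp_curry]
  congr 1
  rw [← Category.comp_id H, ← map_curry_symm, ← Category.assoc, ← Category.assoc]
  simp

@[simp]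
lemma revPath_revPath (Y : C) : revPath hι Y ≫ revPath hι Y = 𝟙 _ := by
  rw [comp_revPath, revPath, Equiv.symm_apply_apply, ← Category.assoc, prod.map_map,
    ← ι.map_comp, Box.reversal_reversal]
  simp

@[simp]
lemma revPath_ev (k : Bool) (Y : C) : revPath hι Y ≫ ev hι k Y = ev hι (!k) Y := by
  rw [revPath, curry_ev, ev, ← Category.assoc]
  congr 1
  simp [cylEnd, endAt, ← ι.map_comp, Box.endpoint_reversal]

/-! ### Connections -/

/-- The connections `I × I ⟶ I`. -/
noncomputable def connection (k : Bool) :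
    ι.obj (.cube 1) ⨯ ι.obj (.cube 1) ⟶ ι.obj (.cube 1) :=
  hι.isProduct.some.lift (BinaryFan.mk prod.fst prod.snd) ≫ ι.map (Box.connection k)

lemma lift_connection (k : Bool) (a b : Box.cube 1 ⟶ Box.cube 1) :
    prod.lift (ι.map a) (ι.map b) ≫ connection hι k = ι.map (Box.pair a b ≫ Box.connection k) := by
  rw [connection, ← Category.assoc, ι.map_comp]
  congr 1
  refine BinaryFan.IsLimit.hom_ext hι.isProduct.some ?_ ?_
  · refine (Category.assoc _ _ _).trans ((_ ≫=
      hι.isProduct.some.fac (BinaryFan.mk prod.fst prod.snd) ⟨.left⟩).trans ?_)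
    simp [← ι.map_comp, Box.pair_proj_zero, prod.lift_fst]
  · refine (Category.assoc _ _ _).trans ((_ ≫=
      hι.isProduct.some.fac (BinaryFan.mk prod.fst prod.snd) ⟨.right⟩).trans ?_)
    simp [← ι.map_comp, Box.pair_proj_one, prod.lift_snd]

lemma endAt_cube (k : Bool) :
    endAt hι k (ι.obj (.cube 1)) = ι.map (Box.collapse ≫ Box.endpoint k) := by
  rw [endAt, ι.map_comp, toPt_ext hι (toPt hι _) (ι.map Box.collapse)]

lemma lift_endAt_connection (k : Bool) {X : C} (t : X ⟶ ι.obj (.cube 1)) :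
    prod.lift (endAt hι k X) t ≫ connection hι k = endAt hι k X := by
  have h := lift_connection hι k (Box.collapse ≫ Box.endpoint k) (𝟙 _)
  rw [Box.pair_endpoint_id_connection, ← endAt_cube hι, ι.map_id] at h
  simpa [prod.comp_lift_assoc] using t ≫= h

lemma lift_connection_endAt (k : Bool) {X : C} (t : X ⟶ ι.obj (.cube 1)) :
    prod.lift t (endAt hι k X) ≫ connection hι k = endAt hι k X := by
  have h := lift_connection hι k (𝟙 _) (Box.collapse ≫ Box.endpoint k)
  rw [Box.pair_id_endpoint_connection, ← endAt_cube hι, ι.map_id] at h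
  simpa [prod.comp_lift_assoc] using t ≫= h

lemma lift_endAt_not_connection (k : Bool) {X : C} (t : X ⟶ ι.obj (.cube 1)) :
    prod.lift (endAt hι (!k) X) t ≫ connection hι k = t := by
  have h := lift_connection hι k (Box.collapse ≫ Box.endpoint (!k)) (𝟙 _)
  rw [Box.pair_endpoint_not_id_connection, ← endAt_cube hι, ι.map_id] at h
  simpa [prod.comp_lift_assoc] using t ≫= h

lemma lift_connection_endAt_not (k : Bool) {X : C} (t : X ⟶ ι.obj (.cube 1)) :
    prod.lift t (endAt hι (!k) X) ≫ connection hι k = t := by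
  have h := lift_connection hι k (𝟙 _) (Box.collapse ≫ Box.endpoint (!k))
  rw [Box.pair_id_endpoint_not_connection, ← endAt_cube hι, ι.map_id] at h
  simpa [prod.comp_lift_assoc] using t ≫= h

/-- The square of paths `(s, t) ↦ γ (s * t)`, for the connection `*` with absorbing
endpoint `k`. -/
noncomputable def connect (k : Bool) {A Y : C} (γ : A ⟶ (path hι).obj Y) :
    A ⨯ ι.obj (.cube 1) ⟶ (path hι).obj Y :=
  curry hι (prod.lift (prod.fst ≫ prod.fst)
    (prod.lift (prod.fst ≫ prod.snd) prod.snd ≫ connection hι k) ≫ (curry hι).symm γ)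

lemma cylEnd_connect (l k : Bool) {A Y : C} (γ : A ⟶ (path hι).obj Y) :
    cylEnd hι l A ≫ connect hι k γ = curry hι (prod.lift prod.fst
      (prod.lift (endAt hι l _) prod.snd ≫ connection hι k) ≫ (curry hι).symm γ) := by
  rw [connect, comp_curry]
  congr 1
  simp [cylEnd, prod.comp_lift_assoc, prod.lift_fst, prod.lift_snd]

lemma connect_ev (l k : Bool) {A Y : C} (γ : A ⟶ (path hι).obj Y) :
    connect hι k γ ≫ ev hι l Y = prod.lift prod.fst
      (prod.lift prod.snd (endAt hι l _) ≫ connection hι k) ≫ (curry hι).symm γ := by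
  rw [connect, curry_ev]
  simp [cylEnd, prod.comp_lift_assoc, prod.lift_snd, prod.lift_fst_assoc]

lemma lift_fst_endAt (k : Bool) {A Y : C} (γ : A ⟶ (path hι).obj Y) :
    prod.lift prod.fst (endAt hι k _) ≫ (curry hι).symm γ =
      (prod.fst : A ⨯ ι.obj (.cube 1) ⟶ A) ≫ γ ≫ ev hι k Y := by
  rw [comp_ev, ← Category.assoc]
  congr 1
  simp [cylEnd, prod.comp_lift]

lemma cylEnd_connect_self (k : Bool) {A Y : C} (γ : A ⟶ (path hι).obj Y) :
    cylEnd hι k A ≫ connect hι k γ = (γ ≫ ev hι k Y) ≫ constPath hι Y := by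
  rw [cylEnd_connect, lift_endAt_connection, lift_fst_endAt, comp_constPath]

lemma cylEnd_not_connect (k : Bool) {A Y : C} (γ : A ⟶ (path hι).obj Y) :
    cylEnd hι (!k) A ≫ connect hι k γ = γ := by
  rw [cylEnd_connect, lift_endAt_not_connection]
  simp

lemma curry_connect_ev_self (k : Bool) {A Y : C} (γ : A ⟶ (path hι).obj Y) :
    curry hι (connect hι k γ ≫ ev hι k Y) = (γ ≫ ev hι k Y) ≫ constPath hι Y := by
  rw [connect_ev, lift_connection_endAt, lift_fst_endAt, comp_constPath]

lemma curry_connect_ev_not (k : Bool) {A Y : C} (γ : A ⟶ (path hι).obj Y) :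
    curry hι (connect hι k γ ≫ ev hι (!k) Y) = γ := by
  rw [connect_ev, lift_connection_endAt_not]
  simp

end Path

lemma cof_le_llp_rlp {C : Type u} [Category.{v} C] (W : MorphismProperty C) :
    cof W ≤ W.rlp.llp :=
  MorphismProperty.retracts_transfiniteComposition_pushouts_coproducts_le_llp_rlp W

lemma rlp_genCof_iff {C : Type u} [Category.{v} C] (ι : Box ⥤ C) {X Y : C} (p : X ⟶ Y) :
    (genCof ι).rlp p ↔ ∀ n, HasLiftingProperty (ι.map (Box.i n)) p :=
  ⟨fun h n => h _ ⟨n⟩, by rintro h _ _ _ ⟨n⟩; exact h n⟩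

lemma rlp_genTrivCof_iff {C : Type u} [Category.{v} C] (ι : Box ⥤ C) {X Y : C} (p : X ⟶ Y) :
    (genTrivCof ι).rlp p ↔ ∀ n, HasLiftingProperty (ι.map (Box.j n)) p :=
  ⟨fun h n => h _ ⟨n⟩, by rintro h _ _ _ ⟨n⟩; exact h n⟩

section Homotopy

variable {C : Type u} [Category.{v} C] [HasLimits C] [HasColimits C] {ι : Box ⥤ C}
  (hι : IsQStructure ι)

/-! ### Extension and lifting of homotopies -/

lemma rlp_genTrivCof_terminal {C : Type u} [Category.{v} C] [HasLimits C] (ι : Box ⥤ C) (Y : C) :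
    (genTrivCof ι).rlp (terminal.from Y) := by
  refine (rlp_genTrivCof_iff ι _).2 fun n => ?_
  refine ⟨fun {f g} sq => ⟨⟨⟨ι.map (Box.init n) ≫ f, ?_, Subsingleton.elim _ _⟩⟩⟩⟩
  rw [← Category.assoc, ← ι.map_comp, Box.j_init, ι.map_id, Category.id_comp]

include hι in
lemma hasLiftingProperty_pushoutProduct_i_endpoint (n : ℕ) {E F : C} {p : E ⟶ F}
    (hp : (genTrivCof ι).rlp p) :
    HasLiftingProperty (pushoutProduct (ι.map (Box.i n)) (ι.map (Box.endpoint false))) p := by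
  have h := cof_le_llp_rlp _ _ (hι.pushoutProduct_i_j n 0) p hp
  rwa [Box.j_zero] at h

/-- Homotopies can be lifted along fibrations relative to the boundary of a cube. -/
lemma exists_homotopy_lift (n : ℕ) {E F : C} {p : E ⟶ F} (hp : (genTrivCof ι).rlp p)
    (a : ι.obj (.boundary n) ⟶ (path hι).obj E) (b : ι.obj (.cube n) ⟶ E)
    (c : ι.obj (.cube n) ⟶ (path hι).obj F) (hab : a ≫ ev hι false E = ι.map (Box.i n) ≫ b)
    (hbc : c ≫ ev hι false F = b ≫ p) (hac : ι.map (Box.i n) ≫ c = a ≫ (path hι).map p) :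
    ∃ K : ι.obj (.cube n) ⟶ (path hι).obj E, ι.map (Box.i n) ≫ K = a ∧
      K ≫ ev hι false E = b ∧ K ≫ (path hι).map p = c := by
  obtain ⟨a, rfl⟩ := (curry hι).surjective a
  obtain ⟨c, rfl⟩ := (curry hι).surjective c
  rw [curry_ev] at hab hbc
  rw [comp_curry, curry_map, EmbeddingLike.apply_eq_iff_eq] at hac
  obtain ⟨K, h₁, h₂, h₃⟩ := exists_lift_of_pushoutProduct
    (hasLiftingProperty_pushoutProduct_i_endpoint hι n hp) a (prod.fst ≫ b) c
    (by rw [map_endpoint hι, Category.assoc, hab, prod.map_fst_assoc]) hac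
    (by rw [map_endpoint hι, Category.assoc, hbc, Category.assoc])
  refine ⟨curry hι K, by rw [comp_curry, h₁], ?_, by rw [curry_map, h₃]⟩
  rw [curry_ev, ← map_endpoint_comp_iff hι, h₂]

/-- The homotopy extension property. -/
lemma hasLiftingProperty_ev {A B : C} {i : A ⟶ B} (hi : (genCof ι).rlp.llp i) (Y : C) :
    HasLiftingProperty i (ev hι false Y) := by
  refine hi _ ((rlp_genCof_iff ι _).2 fun n => ?_)
  refine ⟨fun {f g} sq => ?_⟩
  obtain ⟨K, h₁, h₂, -⟩ := exists_homotopy_lift hι n (rlp_genTrivCof_terminal ι Y) f g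
    (curry hι (terminal.from _)) sq.w (Subsingleton.elim _ _)
    ((curry hι).symm.injective (Subsingleton.elim _ _))
  exact ⟨⟨⟨K, h₁, h₂⟩⟩⟩

lemma exists_homotopy_extension {A B : C} {i : A ⟶ B} (hi : (genCof ι).rlp.llp i) {Y : C}
    (k : Bool) (a : A ⟶ (path hι).obj Y) (b : B ⟶ Y) (hab : a ≫ ev hι k Y = i ≫ b) :
    ∃ K : B ⟶ (path hι).obj Y, i ≫ K = a ∧ K ≫ ev hι k Y = b := by
  have := hasLiftingProperty_ev hι hi Y
  cases k with
  | false =>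
    have sq : CommSq a i (ev hι false Y) b := ⟨hab⟩
    exact ⟨sq.lift, sq.fac_left, sq.fac_right⟩
  | true =>
    have sq : CommSq (a ≫ revPath hι Y) i (ev hι false Y) b := ⟨by simpa using hab⟩
    exact ⟨sq.lift ≫ revPath hι Y, by simp, by simp⟩

/-- Lifting of homotopies with prescribed ends and prescribed restriction. -/
lemma exists_lift_of_pushoutProduct_boundary {A B E F : C} {i : A ⟶ B} {p : E ⟶ F}
    (h : HasLiftingProperty (pushoutProduct i (ι.map (Box.i 1))) p)
    (a : A ⨯ ι.obj (.cube 1) ⟶ E) (b : Bool → (B ⟶ E)) (c : B ⨯ ι.obj (.cube 1) ⟶ F)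
    (hab : ∀ k, cylEnd hι k A ≫ a = i ≫ b k) (hbc : ∀ k, cylEnd hι k B ≫ c = b k ≫ p)
    (hac : prod.map i (𝟙 _) ≫ c = a ≫ p) :
    ∃ K : B ⨯ ι.obj (.cube 1) ⟶ E, prod.map i (𝟙 _) ≫ K = a ∧
      (∀ k, cylEnd hι k B ≫ K = b k) ∧ K ≫ p = c := by
  have hom_ext {X Z : C} {f g : X ⨯ ι.obj (.boundary 1) ⟶ Z}
      (H : ∀ k, prod.map (𝟙 X) (ι.map (Box.boundaryEndpoint k)) ≫ f =
        prod.map (𝟙 X) (ι.map (Box.boundaryEndpoint k)) ≫ g) : f = g :=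
    BinaryCofan.IsColimit.hom_ext (hι.prod_boundary X).some (H false) (H true)
  have map_i (k : Bool) (X : C) : prod.map (𝟙 X) (ι.map (Box.boundaryEndpoint k)) ≫
      prod.map (𝟙 X) (ι.map (Box.i 1)) = prod.fst ≫ cylEnd hι k X := by
    rw [prod.map_map, ← ι.map_comp, Box.boundaryEndpoint_i, Category.comp_id, map_endpoint hι]
  obtain ⟨b', hb'⟩ : ∃ b' : B ⨯ ι.obj (.boundary 1) ⟶ E,
      ∀ k, prod.map (𝟙 B) (ι.map (Box.boundaryEndpoint k)) ≫ b' = prod.fst ≫ b k := by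
    obtain ⟨l, h₀, h₁⟩ := BinaryCofan.IsColimit.desc' (hι.prod_boundary B).some
      (prod.fst ≫ b false) (prod.fst ≫ b true)
    exact ⟨l, fun k => by cases k; exacts [h₀, h₁]⟩
  obtain ⟨K, h₁, h₂, h₃⟩ := exists_lift_of_pushoutProduct h a b' c
    (hom_ext fun k => by
      rw [← Category.assoc, map_i, Category.assoc, hab, ← Category.assoc (prod.map (𝟙 A) _),
        prod.map_map, Category.id_comp, Category.comp_id, ← Category.comp_id i,
        ← Category.id_comp (ι.map (Box.boundaryEndpoint k)), ← prod.map_map, Category.assoc,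
        Category.assoc, hb', prod.map_fst_assoc]
      simp) hac
    (hom_ext fun k => by
      rw [← Category.assoc, map_i, Category.assoc, hbc, ← Category.assoc (prod.map _ _) b', hb',
        Category.assoc])
  refine ⟨K, h₁, fun k => ?_, h₃⟩
  rw [← map_endpoint_comp_iff hι, ← hb', ← h₂, ← Category.assoc, map_i, map_endpoint hι]

include hι in
lemma llp_pushoutProduct_i_i (n : ℕ) :
    (genCof ι).rlp.llp (pushoutProduct (ι.map (Box.i n)) (ι.map (Box.i 1))) :=
  cof_le_llp_rlp _ _ (hι.pushoutProduct_i_i n 1)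

/-- Open boxes in `Iⁿ × I × I` with prescribed restriction to `∂Iⁿ × I × I` can be filled. -/
lemma exists_box_filler (n : ℕ) {Y : C}
    (a : ι.obj (.boundary n) ⨯ ι.obj (.cube 1) ⟶ (path hι).obj Y)
    (b : Bool → (ι.obj (.cube n) ⟶ (path hι).obj Y)) (G : ι.obj (.cube n) ⟶ (path hι).obj Y)
    (hab : ∀ k, cylEnd hι k _ ≫ a = ι.map (Box.i n) ≫ b k)
    (hG : ∀ k, G ≫ ev hι k Y = b k ≫ ev hι false Y)
    (haG : ι.map (Box.i n) ≫ G = curry hι (a ≫ ev hι false Y)) :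
    ∃ H : ι.obj (.cube n) ⟶ (path hι).obj Y, (∀ k, H ≫ ev hι k Y = b k ≫ ev hι true Y) ∧
      ι.map (Box.i n) ≫ H = curry hι (a ≫ ev hι true Y) := by
  obtain ⟨G, rfl⟩ := (curry hι).surjective G
  rw [comp_curry, EmbeddingLike.apply_eq_iff_eq] at haG
  obtain ⟨K, h₁, h₂, -⟩ := exists_lift_of_pushoutProduct_boundary hι
    (hasLiftingProperty_ev hι (llp_pushoutProduct_i_i hι n) Y) a b G hab
    (fun k => by rw [← hG, curry_ev]) haG
  exact ⟨curry hι (K ≫ ev hι true Y), fun k => by rw [curry_ev, ← Category.assoc, h₂],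
    by rw [comp_curry, ← Category.assoc, h₁]⟩

/-- Concatenation of a homotopy relative to the boundary with a homotopy. -/
lemma exists_homotopy_concat (n : ℕ) {Y : C} (γ : ι.obj (.boundary n) ⟶ (path hι).obj Y)
    (G R : ι.obj (.cube n) ⟶ (path hι).obj Y)
    (hG : ι.map (Box.i n) ≫ G = (γ ≫ ev hι false Y) ≫ constPath hι Y)
    (hR : ι.map (Box.i n) ≫ R = γ) (hGR : G ≫ ev hι true Y = R ≫ ev hι false Y) :
    ∃ H : ι.obj (.cube n) ⟶ (path hι).obj Y, H ≫ ev hι false Y = G ≫ ev hι false Y ∧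
      H ≫ ev hι true Y = R ≫ ev hι true Y ∧ ι.map (Box.i n) ≫ H = γ := by
  obtain ⟨H, h₁, h₂⟩ := exists_box_filler hι n (connect hι false γ)
    (fun k => bif k then R else G ≫ ev hι false Y ≫ constPath hι Y) G
    (by
      rintro (_ | _)
      · rw [cylEnd_connect_self]
        simp [reassoc_of% hG]
      · exact (cylEnd_not_connect hι false γ).trans hR.symm)
    (by
      rintro (_ | _)
      · simp
      · exact hGR)
    (by rw [curry_connect_ev_self, hG])
  refine ⟨H, by simpa using h₁ false, h₁ true, h₂.trans (curry_connect_ev_not hι false γ)⟩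

/-- Concatenation of the reverse of a homotopy with a homotopy which has the same restriction to
the boundary. -/
lemma exists_homotopy_rev_concat (n : ℕ) {Y : C} (γ : ι.obj (.boundary n) ⟶ (path hι).obj Y)
    (L G : ι.obj (.cube n) ⟶ (path hι).obj Y) (hG : ι.map (Box.i n) ≫ G = γ)
    (hL : ι.map (Box.i n) ≫ L = γ) (hGL : G ≫ ev hι false Y = L ≫ ev hι false Y) :
    ∃ H : ι.obj (.cube n) ⟶ (path hι).obj Y, H ≫ ev hι false Y = L ≫ ev hι true Y ∧
      H ≫ ev hι true Y = G ≫ ev hι true Y ∧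
      ι.map (Box.i n) ≫ H = (γ ≫ ev hι true Y) ≫ constPath hι Y := by
  obtain ⟨H, h₁, h₂⟩ := exists_box_filler hι n (connect hι true γ)
    (fun k => bif k then G ≫ ev hι true Y ≫ constPath hι Y else L) G
    (by
      rintro (_ | _)
      · exact (cylEnd_not_connect hι true γ).trans hL.symm
      · rw [cylEnd_connect_self]
        simp [reassoc_of% hG])
    (by
      rintro (_ | _)
      · exact hGL
      · simp)
    (by rw [hG]; exact (curry_connect_ev_not hι true γ).symm)
  refine ⟨H, h₁ false, by simpa using h₁ true, h₂.trans (curry_connect_ev_self hι true γ)⟩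

/-! ### Weak equivalences -/

lemma homotopicRel_iff {A X Y : C} {i : A ⟶ X} {f g : X ⟶ Y} :
    HomotopicRel ι i f g ↔ ∃ H : X ⟶ (path hι).obj Y, H ≫ ev hι false Y = f ∧
      H ≫ ev hι true Y = g ∧ i ≫ H = (i ≫ f) ≫ constPath hι Y := by
  constructor
  · rintro ⟨-, H, ⟨h₀, h₁⟩, h⟩
    refine ⟨curry hι H, ?_, ?_, ?_⟩
    · rw [curry_ev]
      exact (map_endpoint_comp_iff hι false H f).1 h₀
    · rw [curry_ev]
      exact (map_endpoint_comp_iff hι true H g).1 h₁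
    · rw [comp_curry, h, comp_constPath]
  · rintro ⟨H, h₀, h₁, h⟩
    obtain ⟨H, rfl⟩ := (curry hι).surjective H
    rw [curry_ev] at h₀ h₁
    refine ⟨?_, H, ⟨(map_endpoint_comp_iff hι false H f).2 h₀,
      (map_endpoint_comp_iff hι true H g).2 h₁⟩, ?_⟩
    · have := h =≫ ev hι true Y
      rw [Category.assoc, curry_ev, h₁] at this
      simpa using this.symm
    · rwa [comp_constPath, comp_curry, EmbeddingLike.apply_eq_iff_eq] at h

lemma weakEq_iff {X Y : C} {f : X ⟶ Y} :
    weakEq ι f ↔ ∀ (n : ℕ) (u : ι.obj (.boundary n) ⟶ X) (v : ι.obj (.cube n) ⟶ Y),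
      u ≫ f = ι.map (Box.i n) ≫ v → ∃ (h : ι.obj (.cube n) ⟶ X)
        (H : ι.obj (.cube n) ⟶ (path hι).obj Y), ι.map (Box.i n) ≫ h = u ∧
        H ≫ ev hι false Y = h ≫ f ∧ H ≫ ev hι true Y = v ∧
        ι.map (Box.i n) ≫ H = (u ≫ f) ≫ constPath hι Y := by
  constructor
  · intro hf n u v huv
    obtain ⟨h, hu, hH⟩ := hf n n le_rfl u v huv
    obtain ⟨H, h₀, h₁, h₂⟩ := (homotopicRel_iff hι).1 hH
    exact ⟨h, H, hu, h₀, h₁, by rw [h₂, ← Category.assoc, hu]⟩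
  · intro hf _ n _ u v huv
    obtain ⟨h, H, hu, h₀, h₁, h₂⟩ := hf n u v huv
    exact ⟨h, hu, (homotopicRel_iff hι).2 ⟨H, h₀, h₁, by rw [h₂, ← Category.assoc, hu]⟩⟩

/-- The mapping path fibration of `f : X ⟶ Y`, from the object of pairs of a point `x` of `X` and
a path in `Y` starting at `f x` to `Y`, sends such a pair to the end of the path. -/
noncomputable def pathFibration {X Y : C} (f : X ⟶ Y) : pullback f (ev hι false Y) ⟶ Y :=
  pullback.snd _ _ ≫ ev hι true Y

lemma rlp_pathFibration {X Y : C} {f : X ⟶ Y} (hf : weakEq ι f) :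
    (genCof ι).rlp (pathFibration hι f) := by
  refine (rlp_genCof_iff ι _).2 fun n => ⟨fun {s v} sq => ?_⟩
  obtain ⟨u, γ, huγ, rfl⟩ : ∃ (u : ι.obj (.boundary n) ⟶ X)
      (γ : ι.obj (.boundary n) ⟶ (path hι).obj Y) (h : u ≫ f = γ ≫ ev hι false Y),
      s = pullback.lift u γ h :=
    ⟨s ≫ pullback.fst _ _, s ≫ pullback.snd _ _, by simp [pullback.condition],
      by
        apply pullback.hom_ext
        exacts [(pullback.lift_fst _ _ _).symm, (pullback.lift_snd _ _ _).symm]⟩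
  have hγ : γ ≫ ev hι true Y = ι.map (Box.i n) ≫ v := by
    simpa [pathFibration, pullback.lift_snd_assoc] using sq.w
  obtain ⟨Γ, hΓ₁, hΓ₂⟩ := exists_homotopy_extension hι
    (MorphismProperty.le_llp_rlp _ _ ⟨n⟩) true γ v hγ
  obtain ⟨h, G, h₁, h₂, h₃, h₄⟩ := (weakEq_iff hι).1 hf n u (Γ ≫ ev hι false Y)
    (by rw [huγ, ← Category.assoc, hΓ₁])
  obtain ⟨H, hH₁, hH₂, hH₃⟩ := exists_homotopy_concat hι n γ G Γ (by rw [h₄, huγ]) hΓ₁ h₃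
  refine ⟨⟨⟨pullback.lift h H (by rw [hH₁, h₂]), ?_, ?_⟩⟩⟩
  · apply pullback.hom_ext
    · simp [pullback.lift_fst, h₁]
    · simp [pullback.lift_snd, hH₃]
  · simp [pathFibration, pullback.lift_snd_assoc, hH₂, hΓ₂]

/-- A weak equivalence has the homotopy right lifting property against all cofibrations. -/
lemma exists_homotopy_lift_of_weakEq {X Y A B : C} {f : X ⟶ Y} (hf : weakEq ι f) {i : A ⟶ B}
    (hi : (genCof ι).rlp.llp i) (u : A ⟶ X) (γ : A ⟶ (path hι).obj Y) (v : B ⟶ Y)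
    (h₀ : γ ≫ ev hι false Y = u ≫ f) (h₁ : γ ≫ ev hι true Y = i ≫ v) :
    ∃ (h : B ⟶ X) (H : B ⟶ (path hι).obj Y), i ≫ h = u ∧ i ≫ H = γ ∧
      H ≫ ev hι false Y = h ≫ f ∧ H ≫ ev hι true Y = v := by
  have := hi _ (rlp_pathFibration hι hf)
  have sq : CommSq (pullback.lift u γ h₀.symm) i (pathFibration hι f) v :=
    ⟨by rw [pathFibration, pullback.lift_snd_assoc, h₁]⟩
  refine ⟨sq.lift ≫ pullback.fst _ _, sq.lift ≫ pullback.snd _ _, ?_, ?_, ?_, ?_⟩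
  · rw [sq.fac_left_assoc, pullback.lift_fst]
  · rw [sq.fac_left_assoc, pullback.lift_snd]
  · rw [Category.assoc, Category.assoc, pullback.condition]
  · rw [Category.assoc]
    exact sq.fac_right

include hι

lemma weakEq_comp {X Y Z : C} {f : X ⟶ Y} {g : Y ⟶ Z} (hf : weakEq ι f) (hg : weakEq ι g) :
    weakEq ι (f ≫ g) := by
  rw [weakEq_iff hι]
  intro n u w huw
  obtain ⟨k, Γ, hk, hΓ₀, hΓ₁, hΓ⟩ := (weakEq_iff hι).1 hg n (u ≫ f) w (by simpa using huw)
  obtain ⟨h, Δ, hh, hΔ₀, hΔ₁, hΔ⟩ := (weakEq_iff hι).1 hf n u k hk.symm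
  obtain ⟨H, h₀, h₁, h₂⟩ := exists_homotopy_concat hι n (((u ≫ f) ≫ g) ≫ constPath hι Z)
    (Δ ≫ (path hι).map g) Γ (by rw [reassoc_of% hΔ]; simp) hΓ
    (by rw [Category.assoc, path_map_ev, ← Category.assoc, hΔ₁, hΓ₀])
  exact ⟨h, H, hh, by rw [h₀, Category.assoc, path_map_ev, ← Category.assoc, hΔ₀, Category.assoc],
    by rw [h₁, hΓ₁], by rw [h₂, Category.assoc u]⟩

lemma weakEq_of_postcomp {X Y Z : C} {f : X ⟶ Y} {g : Y ⟶ Z} (hg : weakEq ι g)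
    (hfg : weakEq ι (f ≫ g)) : weakEq ι f := by
  rw [weakEq_iff hι]
  intro n u v huv
  obtain ⟨h, K, hu, h₀, h₁, h₂⟩ := (weakEq_iff hι).1 hfg n u (v ≫ g) (by rw [reassoc_of% huv])
  obtain ⟨K, rfl⟩ := (curry hι).surjective K
  rw [curry_ev] at h₀ h₁
  rw [comp_curry, comp_constPath, EmbeddingLike.apply_eq_iff_eq] at h₂
  let σ : Y ⟶ pullback g (ev hι false Z) := pullback.lift (𝟙 Y) (g ≫ constPath hι Z) (by simp)
  have hσ : σ ≫ pathFibration hι g = g := by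
    simp [σ, pathFibration, pullback.lift_snd_assoc]
  have hσ' : σ ≫ pullback.fst _ _ = 𝟙 Y := pullback.lift_fst _ _ _
  obtain ⟨H, hH₁, hH₂, -⟩ := exists_lift_of_pushoutProduct_boundary hι
    (llp_pushoutProduct_i_i hι n _ (rlp_pathFibration hι hg)) (prod.fst ≫ u ≫ f ≫ σ)
    (fun k => (bif k then v else h ≫ f) ≫ σ) K
    (by
      rintro (_ | _)
      · simp [reassoc_of% hu]
      · simp [reassoc_of% huv])
    (by
      rintro (_ | _)
      · simpa [hσ] using h₀
      · simpa [hσ] using h₁)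
    (by rw [h₂]; simp [hσ])
  refine ⟨h, curry hι (H ≫ pullback.fst _ _), hu, ?_, ?_, ?_⟩
  · rw [curry_ev, ← Category.assoc, hH₂]
    simp [hσ']
  · rw [curry_ev, ← Category.assoc, hH₂]
    simp [hσ']
  · rw [comp_curry, comp_constPath, ← Category.assoc, hH₁]
    simp [hσ']

lemma weakEq_of_precomp {X Y Z : C} {f : X ⟶ Y} {g : Y ⟶ Z} (hf : weakEq ι f)
    (hfg : weakEq ι (f ≫ g)) : weakEq ι g := by
  rw [weakEq_iff hι]
  intro n u w huw
  obtain ⟨u', γ, -, -, hγ₀, hγ₁⟩ := exists_homotopy_lift_of_weakEq hι hf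
    (cof_le_llp_rlp _ _ (hι.cof_boundary n)) (initial.to X) (initial.to _) u
    (Subsingleton.elim _ _) (Subsingleton.elim _ _)
  obtain ⟨h', L, hh', hL, hL₀, hL₁⟩ := exists_homotopy_lift_of_weakEq hι hfg
    (MorphismProperty.le_llp_rlp _ _ ⟨n⟩) u' (γ ≫ (path hι).map g) w
    (by simp [reassoc_of% hγ₀]) (by simp [reassoc_of% hγ₁, huw])
  obtain ⟨Γ, hΓ, hΓ₀⟩ := exists_homotopy_extension hι
    (MorphismProperty.le_llp_rlp _ _ ⟨n⟩) false γ (h' ≫ f) (by rw [hγ₀, ← hh', Category.assoc])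
  obtain ⟨H, hH₀, hH₁, hH⟩ := exists_homotopy_rev_concat hι n (γ ≫ (path hι).map g)
    (Γ ≫ (path hι).map g) L hL (by rw [← Category.assoc, hΓ])
    (by simp [hL₀, reassoc_of% hΓ₀])
  refine ⟨Γ ≫ ev hι true Y, H, by rw [← Category.assoc, hΓ, hγ₁], by simpa using hH₀,
    by rw [hH₁, hL₁], ?_⟩
  rw [hH, Category.assoc γ, path_map_ev, ← Category.assoc γ, hγ₁]

lemma weakEq_hasTwoOutOfThreeProperty : (weakEq ι).HasTwoOutOfThreeProperty where
  comp_mem _ _ hf hg := weakEq_comp hι hf hg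
  of_postcomp _ _ hg hfg := weakEq_of_postcomp hι hg hfg
  of_precomp _ _ hf hfg := weakEq_of_precomp hι hf hfg

/-! ### Trivial fibrations and trivial cofibrations -/

lemma rlp_genCof_eq : (genCof ι).rlp = (genTrivCof ι).rlp ⊓ weakEq ι := by
  ext X Y p
  constructor
  · intro hp
    refine ⟨?_, ?_⟩
    · refine (rlp_genTrivCof_iff ι _).2 fun n => ?_
      exact cof_le_llp_rlp _ _ (hι.cof_j n) p hp
    · rw [weakEq_iff hι]
      intro n u v huv
      have := hp _ ⟨n⟩
      have sq : CommSq u (ι.map (Box.i n)) p v := ⟨huv⟩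
      exact ⟨sq.lift, v ≫ constPath hι Y, sq.fac_left, by simp, by simp, by simp [huv]⟩
  · rintro ⟨hp, hp'⟩
    refine (rlp_genCof_iff ι _).2 fun n => ⟨fun {u v} sq => ?_⟩
    obtain ⟨h, H, h₁, h₂, h₃, h₄⟩ := (weakEq_iff hι).1 hp' n u v sq.w
    obtain ⟨K, hK₁, hK₂, hK₃⟩ := exists_homotopy_lift hι n hp (u ≫ constPath hι X) h H
      (by simp [h₁]) h₂ (by rw [h₄]; simp)
    refine ⟨⟨⟨K ≫ ev hι true X, ?_, ?_⟩⟩⟩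
    · rw [← Category.assoc, hK₁]
      simp
    · rw [Category.assoc, ← path_map_ev, ← Category.assoc, hK₃, h₃]

lemma hasLiftingProperty_pushoutProduct_j_i (n : ℕ) {E F : C} {p : E ⟶ F}
    (hp : (genTrivCof ι).rlp p) :
    HasLiftingProperty (pushoutProduct (ι.map (Box.j n)) (ι.map (Box.i 1))) p :=
  hasLiftingProperty_pushoutProduct_symm
    (cof_le_llp_rlp _ _ (hι.pushoutProduct_i_j 1 n) p hp)

lemma weakEq_of_llp {X Y : C} {f : X ⟶ Y} (hf : (genTrivCof ι).rlp.llp f) : weakEq ι f := by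
  have := hf _ (rlp_genTrivCof_terminal ι X)
  have sq : CommSq (𝟙 X) f (terminal.from X) (terminal.from Y) := ⟨Subsingleton.elim _ _⟩
  have hr : f ≫ sq.lift = 𝟙 X := sq.fac_left
  generalize sq.lift = r at hr
  have hY : (genTrivCof ι).rlp (prod.lift (ev hι false Y) (ev hι true Y)) := by
    refine (rlp_genTrivCof_iff ι _).2 fun n => ⟨fun {a b} sq => ?_⟩
    obtain ⟨a, rfl⟩ := (curry hι).surjective a
    have h₀ : cylEnd hι false _ ≫ a = ι.map (Box.j n) ≫ b ≫ prod.fst := by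
      simpa [prod.lift_fst] using sq.w =≫ prod.fst
    have h₁ : cylEnd hι true _ ≫ a = ι.map (Box.j n) ≫ b ≫ prod.snd := by
      simpa [prod.lift_snd] using sq.w =≫ prod.snd
    obtain ⟨K, hK₁, hK₂, -⟩ := exists_lift_of_pushoutProduct_boundary hι
      (hasLiftingProperty_pushoutProduct_j_i hι n (rlp_genTrivCof_terminal ι Y)) a
      (fun k => b ≫ bif k then prod.snd else prod.fst) (terminal.from _)
      (by rintro (_ | _); exacts [h₀, h₁]) (fun _ => Subsingleton.elim _ _)
      (Subsingleton.elim _ _)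
    refine ⟨⟨⟨curry hι K, by rw [comp_curry, hK₁], ?_⟩⟩⟩
    ext
    · rw [Category.assoc, prod.lift_fst, curry_ev, hK₂]
      rfl
    · rw [Category.assoc, prod.lift_snd, curry_ev, hK₂]
      rfl
  have := hf _ hY
  have sq : CommSq (f ≫ constPath hι Y) f (prod.lift (ev hι false Y) (ev hι true Y))
      (prod.lift (r ≫ f) (𝟙 Y)) := ⟨by simp [prod.comp_lift, reassoc_of% hr]⟩
  have hH₀ : sq.lift ≫ ev hι false Y = r ≫ f := by
    simpa [prod.lift_fst] using sq.fac_right =≫ prod.fst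
  have hH₁ : sq.lift ≫ ev hι true Y = 𝟙 Y := by
    simpa [prod.lift_snd] using sq.fac_right =≫ prod.snd
  have hH : f ≫ sq.lift = f ≫ constPath hι Y := sq.fac_left
  rw [weakEq_iff hι]
  intro n u v huv
  refine ⟨v ≫ r, v ≫ sq.lift, by rw [← reassoc_of% huv, hr, Category.comp_id],
    by simp [hH₀], by simp [hH₁], ?_⟩
  rw [← reassoc_of% huv, hH, Category.assoc]

lemma hasSmallObjectArgument_genCof :
    MorphismProperty.HasSmallObjectArgument.{v} (genCof ι) :=
  hasSmallObjectArgument_ofHoms _ hι.small_boundary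

lemma hasSmallObjectArgument_genTrivCof :
    MorphismProperty.HasSmallObjectArgument.{v} (genTrivCof ι) :=
  hasSmallObjectArgument_ofHoms _ hι.small_cube

lemma llp_rlp_genTrivCof_eq :
    (genTrivCof ι).rlp.llp = (genCof ι).rlp.llp ⊓ weakEq ι := by
  have := hasSmallObjectArgument_genTrivCof hι
  refine le_antisymm (le_inf (MorphismProperty.antitone_llp ?_) fun _ _ _ => weakEq_of_llp hι) ?_
  · rw [rlp_genCof_eq hι]
    exact inf_le_left
  · rintro X Y f ⟨hf, hf'⟩
    let d := MorphismProperty.factorizationData (genTrivCof ι).rlp.llp (genTrivCof ι).rlp f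
    have hp : (genCof ι).rlp d.p := by
      rw [rlp_genCof_eq hι]
      refine ⟨d.hp, weakEq_of_precomp hι (weakEq_of_llp hι d.hi) ?_⟩
      rwa [d.fac]
    have := hf _ hp
    exact MorphismProperty.of_retract (RetractArrow.ofLeftLiftingProperty d.fac) d.hi

end Homotopy

end Serre

theorem mainTheorem1 {C : Type u} [CategoryTheory.Category.{v} C]
    [CategoryTheory.Limits.HasLimits C] [CategoryTheory.Limits.HasColimits C]
    (ι : Serre.Box ⥤ C) (hι : Serre.IsQStructure ι) :
    ∃ _ : HomotopicalAlgebra.ModelCategory C,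
      HomotopicalAlgebra.cofibrations C = Serre.cof (Serre.genCof ι) ∧
      HomotopicalAlgebra.fibrations C = (Serre.genTrivCof ι).rlp ∧
      HomotopicalAlgebra.weakEquivalences C = Serre.weakEq ι := by
  have hI := Serre.hasSmallObjectArgument_genCof hι
  have hJ := Serre.hasSmallObjectArgument_genTrivCof hι
  have hcof := Serre.cof_eq_llp (Serre.genCof ι)
  let : HomotopicalAlgebra.CategoryWithCofibrations C := ⟨Serre.cof (Serre.genCof ι)⟩
  let : HomotopicalAlgebra.CategoryWithFibrations C := ⟨(Serre.genTrivCof ι).rlp⟩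
  let : HomotopicalAlgebra.CategoryWithWeakEquivalences C := ⟨Serre.weakEq ι⟩
  have : (HomotopicalAlgebra.weakEquivalences C).HasTwoOutOfThreeProperty :=
    Serre.weakEq_hasTwoOutOfThreeProperty hι
  have hc : HomotopicalAlgebra.cofibrations C = (Serre.genCof ι).rlp.llp := hcof
  have htf : HomotopicalAlgebra.trivialFibrations C = (Serre.genCof ι).rlp :=
    (Serre.rlp_genCof_eq hι).symm
  have htc : HomotopicalAlgebra.trivialCofibrations C = (Serre.genTrivCof ι).rlp.llp := by
    rw [Serre.llp_rlp_genTrivCof_eq hι, ← hc]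
    rfl
  have hf : HomotopicalAlgebra.fibrations C = (Serre.genTrivCof ι).rlp := rfl
  have : MorphismProperty.IsWeakFactorizationSystem (HomotopicalAlgebra.cofibrations C)
      (HomotopicalAlgebra.trivialFibrations C) := by
    rw [hc, htf]
    exact ⟨MorphismProperty.rlp_llp_rlp _, rfl, inferInstance⟩
  have : MorphismProperty.IsWeakFactorizationSystem (HomotopicalAlgebra.trivialCofibrations C)
      (HomotopicalAlgebra.fibrations C) := by
    rw [htc, hf]
    exact ⟨MorphismProperty.rlp_llp_rlp _, rfl, inferInstance⟩
  exact ⟨HomotopicalAlgebra.ModelCategory.mk' C, rfl, rfl, rfl⟩
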